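/- Let $F^*$ be a countable discrete space, let $(Q_{i,j})_{i\neq j}$ be non-negative transition rates on $F^*$ and let $p_0:F^*\to[0,\infty)$ be a death rate. Assume (A): $\mathbf{Q_1}=\sup_{i}\sum_{j\ne i}Q_{i,j}<\infty$ and $\mathbf{p}=\sup_i p_0(i)<\infty$. Let $(P_t)_{t\ge0}$ be the semigroup generated by the (bounded) operator $G$ on bounded functions on $F^*\cup\{0\}$, $Gf(i)=p_0(i)(f(0)-f(i))+\sum_{j\in F^*}Q_{i,j}(f(j)-f(i))$ for $i\in F^*$, $Gf(0)=0$. For a probability measure $\mu$ on $F^*$, $t\ge 0$ and bounded $\varphi:F^*\to\mathbb R$, extended by $\varphi(0)=0$, put $$\mu T_t\varphi=\frac{\sum_{y\in F^*}\mu(y)\,P_t\varphi(y)}{\sum_{y\in F^*}\mu(y)\,P_t\mathbf 1_{F^*}(y)}.$$ For $N\ge 2$ let $E=\{\eta:F^*\to\mathbb N : \sum_i\eta(i)=N\}$, for $\eta(i)\neq0$ let $T_{i\to j}\eta$ be $\eta$ with one particle moved from $i$ to $j$, let $m(\eta)=\frac1N\sum_k\eta(k)\delta_k$, $m(\eta)(\varphi)=\int\varphi\,dm(\eta)$,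 and let $$\mathcal L f(\eta)=\sum_{i\in F^*}\eta(i)\sum_{j\in F^*}\bigl(f(T_{i\to j}\eta)-f(\eta)\bigr)\Bigl(Q_{i,j}+p_0(i)\frac{\eta(j)}{N-1}\Bigr)$$ for bounded $f:E\to\mathbb R$. Finally let $d_{\mathrm{TV}}(\mu,\mu')=\frac12\sup_{\|f\|_\infty\le1}\bigl(\int f\,d\mu-\int f\,d\mu'\bigr)$. **Theorem (Convergence to the conditioned process).** With the explicit constants $B=\mathbf{Q_1}+2\mathbf{p}$ and $C=10$, which depend neither on $N$ nor on $t$, the following holds. For every $N\ge2$, every $\eta\in E$, every probability measure $\mu$ on $F^*$, every Markov process $(\eta_t)_{t\ge0}$ on $E$ whose semigroup is generated by $\mathcal L$ and which starts from $\eta_0=\eta$, and every $t\ge0$, $$\sup_{\|\varphi\|_\infty\le1}\mathbb E_\eta\bigl[\,|m(\eta_t)(\varphi)-\mu T_t\varphi|\,\bigr]\le C\,e^{Bt}\Bigl(\frac1{\sqrt N}+d_{\mathrm{TV}}(m(\eta),\mu)\Bigr).$$ -/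

import Mathlib

open MeasureTheory ProbabilityTheory
open scoped NNReal ENNReal

noncomputable section

namespace FlemingViot

/-- The semigroup `exp (t A)` generated by a bounded operator `A` on bounded functions, as the
exponential series evaluated pointwise. -/
def semigroup {S : Type*} (A : (S → ℝ) → (S → ℝ)) (t : ℝ≥0) (f : S → ℝ) (x : S) : ℝ :=
  ∑' n : ℕ, (t : ℝ) ^ n / (n.factorial : ℝ) * (A^[n] f) x

/-- `X` is a Markov process on `(Ω, P)` (for its own filtration) with values in the discrete space
`S`, whose transition semigroup is the one generated by `A`: for every bounded `f`,
`E[f(X_{s+t}) | σ(X_r, r ≤ s)] = (exp (t A) f)(X_s)` almost surely. -/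
structure IsMarkovProcess {S : Type*} (A : (S → ℝ) → (S → ℝ)) {Ω : Type*} [MeasurableSpace Ω]
    (P : Measure Ω) (X : ℝ≥0 → Ω → S) : Prop where
  measurable : ∀ t, @Measurable Ω S _ ⊤ (X t)
  markov : ∀ (s t : ℝ≥0) (f : S → ℝ), (∃ M : ℝ, ∀ x, |f x| ≤ M) →
    P[fun ω => f (X (s + t) ω) | ⨆ r : {r : ℝ≥0 // r ≤ s}, MeasurableSpace.comap (X r) ⊤]
      =ᵐ[P] fun ω => semigroup A t f (X s ω)

section Rates

variable {F : Type*} (Q : F → F → ℝ) (p₀ : F → ℝ)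

/-- Total jump rate `∑_{j ≠ i} Q_{i,j}` out of the site `i`. -/
def exitRate (i : F) : ℝ := ∑' j : {j : F // j ≠ i}, Q i j

/-- `𝐐₁ = sup_i ∑_{j ≠ i} Q_{i,j}`. -/
def supExitRate : ℝ := ⨆ i, exitRate Q i

/-- `𝐩 = sup_i p₀(i)`. -/
def supDeathRate : ℝ := ⨆ i, p₀ i

/-- The boundedness assumption (A): `𝐐₁ < ∞` and `𝐩 < ∞`. -/
structure BoundedRates : Prop where
  summable : ∀ i, Summable fun j : {j : F // j ≠ i} => Q i j
  bddAbove_exit : BddAbove (Set.range (exitRate Q))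
  bddAbove_death : BddAbove (Set.range p₀)

/-- Generator `G` of the killed chain on `F* ∪ {0}`; here `F` is `F*` and `none` is the absorbing
state `0`. The diagonal entries of `Q` play no role. -/
def killedGenerator (f : Option F → ℝ) : Option F → ℝ
  | none => 0
  | some i => p₀ i * (f none - f (some i)) + ∑' j, Q i j * (f (some j) - f (some i))

/-- Extension of a function on `F*` to `F* ∪ {0}` by the convention `f(0) = 0`. -/
def extendZero (φ : F → ℝ) : Option F → ℝ
  | none => 0
  | some i => φ i

/-- `μ P_t φ`, where `(P_t)` is the semigroup generated by `G` and `φ(0) = 0`. -/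
def killedLaw [MeasurableSpace F] (μ : Measure F) (t : ℝ≥0) (φ : F → ℝ) : ℝ :=
  ∫ y, semigroup (killedGenerator Q p₀) t (extendZero φ) (some y) ∂μ

/-- `μ T_t φ = μ P_t φ / μ P_t 1_{0ᶜ}`: the law at time `t` of the killed chain started from `μ`,
conditioned on non-absorption up to time `t`, applied to `φ`. -/
def conditionedLaw [MeasurableSpace F] (μ : Measure F) (t : ℝ≥0) (φ : F → ℝ) : ℝ :=
  killedLaw Q p₀ μ t φ / killedLaw Q p₀ μ t (fun _ => 1)

end Rates

/-- Configurations of `N` indistinguishable particles: occupation numbers `η : F* → ℕ` with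
`∑ η(i) = N`. -/
def Config (F : Type*) (N : ℕ) : Type _ := {η : F →₀ ℕ // ∑ i ∈ η.support, η i = N}

section Particles

variable {F : Type*} {N : ℕ}

theorem sum_move (η : F →₀ ℕ) (i j : F) (h : η i ≠ 0) :
    ∑ k ∈ (η - Finsupp.single i 1 + Finsupp.single j 1 : F →₀ ℕ).support,
      (η - Finsupp.single i 1 + Finsupp.single j 1 : F →₀ ℕ) k = ∑ k ∈ η.support, η k := by
  have h1 : Finsupp.single i 1 ≤ η := by
    rw [Finsupp.single_le_iff]; omega
  have h2 := congrArg Finsupp.degree (tsub_add_cancel_of_le h1)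
  change Finsupp.degree _ = Finsupp.degree _
  simp only [map_add, Finsupp.degree_single] at h2 ⊢
  exact h2

/-- `T_{i → j} η`: one particle is moved from `i` to `j` (when `η(i) ≠ 0`). -/
def move (η : Config F N) (i j : F) : Config F N :=
  if h : η.1 i ≠ 0 then
    ⟨η.1 - Finsupp.single i 1 + Finsupp.single j 1, (sum_move η.1 i j h).trans η.2⟩
  else η

/-- Generator `𝓛` of the Fleming–Viot system with `N` particles. -/
def particleGenerator (Q : F → F → ℝ) (p₀ : F → ℝ) (f : Config F N → ℝ) (η : Config F N) : ℝ :=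
  ∑ i ∈ η.1.support, (η.1 i : ℝ) *
    ∑' j, (f (move η i j) - f η) * (Q i j + p₀ i * ((η.1 j : ℝ) / ((N : ℝ) - 1)))

/-- The empirical distribution `m(η) = N⁻¹ ∑_k η(k) δ_k`. -/
def empirical [MeasurableSpace F] (η : Config F N) : Measure F :=
  (N : ℝ≥0∞)⁻¹ • ∑ k ∈ η.1.support, (η.1 k : ℝ≥0∞) • Measure.dirac k

end Particles

/-- Total variation distance `½ sup_{‖f‖_∞ ≤ 1} (∫ f dμ - ∫ f dν)` on a discrete space. -/
def tvDist {F : Type*} [MeasurableSpace F] (μ ν : Measure F) : ℝ :=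
  1 / 2 * ⨆ f : {f : F → ℝ // ∀ x, |f x| ≤ 1}, (∫ x, f.1 x ∂μ - ∫ x, f.1 x ∂ν)

end FlemingViot

end

/-!
The expectation of a bounded function `f` of `η_s` is `(exp (s 𝓛) f)(η₀)`, since the process is
Markov and starts from `η₀` (`IsMarkovProcess.integral_eq`). Only these one-time marginals matter,
and the theorem becomes a statement on the positive normalised functionals `E_s f = (exp (s 𝓛) f)(η₀)`
on the Banach algebra of bounded functions.

Let `K` be the generator of the killed chain on functions vanishing at the absorbing state,
`P_s = exp (s K)`, which preserves positivity and is a contraction, and let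
`v_s(f) = μ P_s f / μ P_s 1` be the conditioned law. Fix a final time `T` and a test function `φ` with
`‖φ‖ ≤ 1`, and put `ψ_s = P_{T-s} φ` and `X_s(η) = m(η)(ψ_s) - v_s(ψ_s)`. The empirical mean has drift
`𝓛 (m(ψ)) = m(K ψ) + m(p₀) m(ψ) + O(1/N)`, with a carré du champ of order `1/N`
(`particleOp_sq_le`), whereas `d/ds v_s(ψ_s) = v_s(ψ_s) v_s(p₀)` (`hasDerivAt_condLaw_backward`). In
`d/ds E_s[X_s²]` the terms in `K ψ_s` cancel, and what is left of the drift is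
`m(p₀) m(ψ_s) - v_s(p₀) v_s(ψ_s) = (m - v_s)(p₀) m(ψ_s) + v_s(p₀) X_s`. Centring the death rate,
`(m - v_s)(p₀) = (p/2) (m - v_s)(g)` with `‖g‖ ≤ 1`, gives
`d/ds E_s[X_s²] ≤ 3 p sup_{‖f‖ ≤ 1} E_s[((m - v_s) f)²] + (4 q + 24 p)/N`,
where `q = 𝐐₁` (`particleOp_deviation_sq_add_le`, `hasDerivAt_meanSquare`).

Picard iteration, started from the trivial bound `4`, then yields
`E_T[((m - v_T) φ)²] ≤ exp (3 p T) (4 d² + (4 q + 24 p) T / N)`, with `d` the total variation distance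
at time `0` (`meanSquare_le`). As `3 p` is at most three quarters of `2 B`, where `B = q + 2 p`, the
factor `T` is absorbed into the exponential, and the first moment is at most the square root
of the second.
-/

noncomputable section

namespace FlemingViot

/-! ### Bounded functions and exponentials of bounded operators -/

/-- The Banach algebra of bounded real functions on `S` with the supremum norm. -/
abbrev Bdd (S : Type*) := lp (fun _ : S => ℝ) ∞

/-- A bounded function, as an element of `Bdd S`. -/
def toBdd {S : Type*} (f : S → ℝ) (h : ∃ M : ℝ, ∀ x, |f x| ≤ M) : Bdd S :=
  ⟨f, memℓp_infty (by
    obtain ⟨M, hM⟩ := h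
    exact ⟨M, by rintro _ ⟨x, rfl⟩; exact hM x⟩)⟩

@[simp] theorem toBdd_apply {S : Type*} (f : S → ℝ) (h : ∃ M : ℝ, ∀ x, |f x| ≤ M) (x : S) :
    toBdd f h x = f x := rfl

theorem abs_apply_le_norm {S : Type*} (f : Bdd S) (x : S) : |f x| ≤ ‖f‖ :=
  lp.norm_apply_le_norm ENNReal.top_ne_zero f x

theorem Bdd.norm_le {S : Type*} {f : Bdd S} {C : ℝ} (hC : 0 ≤ C) (h : ∀ x, |f x| ≤ C) : ‖f‖ ≤ C :=
  lp.norm_le_of_forall_le hC h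

@[simp] theorem Bdd.one_apply {S : Type*} (x : S) : (1 : Bdd S) x = 1 := by
  rw [lp.infty_coeFn_one]; rfl

@[simp] theorem Bdd.mul_apply {S : Type*} (f g : Bdd S) (x : S) : (f * g) x = f x * g x := by
  rw [lp.infty_coeFn_mul]; rfl

@[simp] theorem Bdd.add_apply {S : Type*} (f g : Bdd S) (x : S) : (f + g) x = f x + g x := by
  rw [lp.coeFn_add]; rfl

@[simp] theorem Bdd.sub_apply {S : Type*} (f g : Bdd S) (x : S) : (f - g) x = f x - g x := by
  rw [lp.coeFn_sub]; rfl

@[simp] theorem Bdd.smul_apply {S : Type*} (c : ℝ) (f : Bdd S) (x : S) : (c • f) x = c * f x := by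
  rw [lp.coeFn_smul]; rfl

theorem Bdd.ext' {S : Type*} {f g : Bdd S} (h : ∀ x, f x = g x) : f = g :=
  lp.ext (funext h)

/-- Evaluation at a point, as a continuous linear functional. -/
def Bdd.eval {S : Type*} (x : S) : Bdd S →L[ℝ] ℝ := lp.evalCLM ℝ (fun _ : S => ℝ) ∞ x

@[simp] theorem Bdd.eval_apply {S : Type*} (x : S) (f : Bdd S) : Bdd.eval x f = f x := rfl

/-- A linear map between spaces of bounded functions given by a pointwise formula with a uniform
bound. -/
def Bdd.mkCLM {S S' : Type*} (A : Bdd S → S' → ℝ) (C : ℝ) (hC : 0 ≤ C)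
    (hA : ∀ f x, |A f x| ≤ C * ‖f‖) (hadd : ∀ f g x, A (f + g) x = A f x + A g x)
    (hsmul : ∀ (c : ℝ) f x, A (c • f) x = c * A f x) : Bdd S →L[ℝ] Bdd S' :=
  LinearMap.mkContinuous
    { toFun := fun f => toBdd (A f) ⟨_, hA f⟩
      map_add' := fun f g => Bdd.ext' fun x => by simp [hadd]
      map_smul' := fun c f => Bdd.ext' fun x => by simp [hsmul] } C
    fun f => Bdd.norm_le (by positivity) fun x => hA f x

theorem exp_add_smul {𝔸 : Type*} [NormedRing 𝔸] [NormedAlgebra ℝ 𝔸] [CompleteSpace 𝔸] (A : 𝔸)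
    (s t : ℝ) :
    NormedSpace.exp ((s + t) • A) = NormedSpace.exp (s • A) * NormedSpace.exp (t • A) := by
  let _ : NormedAlgebra ℚ 𝔸 := NormedAlgebra.restrictScalars ℚ ℝ _
  rw [add_smul]
  exact NormedSpace.exp_add_of_commute (((Commute.refl A).smul_left s).smul_right t)

theorem exp_smul_mul_comm {𝔸 : Type*} [NormedRing 𝔸] [NormedAlgebra ℝ 𝔸] [CompleteSpace 𝔸]
    (A : 𝔸) (s : ℝ) : NormedSpace.exp (s • A) * A = A * NormedSpace.exp (s • A) := by
  let _ : NormedAlgebra ℚ 𝔸 := NormedAlgebra.restrictScalars ℚ ℝ _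
  exact (((Commute.refl A).smul_left s).exp_left).eq

theorem exp_smul_add_smul_one {𝔸 : Type*} [NormedRing 𝔸] [NormedAlgebra ℝ 𝔸] [CompleteSpace 𝔸]
    (A : 𝔸) (c s : ℝ) :
    NormedSpace.exp (s • (A + c • (1 : 𝔸))) = Real.exp (s * c) • NormedSpace.exp (s • A) := by
  let _ : NormedAlgebra ℚ 𝔸 := NormedAlgebra.restrictScalars ℚ ℝ _
  have h : Commute (s • A) (s • c • (1 : 𝔸)) :=
    ((((Commute.one_right A).smul_right c).smul_right s).smul_left s)
  rw [smul_add, NormedSpace.exp_add_of_commute h, smul_smul, ← Algebra.algebraMap_eq_smul_one,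
    ← NormedSpace.algebraMap_exp_comm, Algebra.algebraMap_eq_smul_one, Real.exp_eq_exp_ℝ]
  simp

section Flow

variable {E : Type*} [NormedAddCommGroup E] [NormedSpace ℝ E]

/-- The exponential `exp (s A)` of a bounded operator. -/
def flow (A : E →L[ℝ] E) (s : ℝ) : E →L[ℝ] E :=
  NormedSpace.exp (s • A)

theorem flow_zero (A : E →L[ℝ] E) : flow A 0 = 1 := by
  simp [flow]

theorem hasSum_flow [CompleteSpace E] (A : E →L[ℝ] E) (s : ℝ) (f : E) :
    HasSum (fun n : ℕ => (s ^ n / (n.factorial : ℝ)) • (A ^ n) f) (flow A s f) := by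
  have h2 := (ContinuousLinearMap.apply ℝ E f).hasSum
    (NormedSpace.exp_series_hasSum_exp' (𝕂 := ℝ) (s • A))
  convert h2 using 2 with n
  · rw [smul_pow, smul_smul, div_eq_inv_mul]
    rfl
  · rfl

theorem hasDerivAt_flow [CompleteSpace E] (A : E →L[ℝ] E) (s : ℝ) :
    HasDerivAt (flow A) (flow A s * A) s :=
  hasDerivAt_exp_smul_const A s

theorem flow_add [CompleteSpace E] (A : E →L[ℝ] E) (s t : ℝ) :
    flow A (s + t) = flow A s * flow A t :=
  exp_add_smul A s t

theorem flow_comm [CompleteSpace E] (A : E →L[ℝ] E) (s : ℝ) : flow A s * A = A * flow A s :=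
  exp_smul_mul_comm A s

theorem flow_add_smul_one [CompleteSpace E] (A : E →L[ℝ] E) (c s : ℝ) :
    flow (A + c • 1) s = Real.exp (s * c) • flow A s := exp_smul_add_smul_one A c s

end Flow

theorem hasSum_flow_apply {S : Type*} (A : Bdd S →L[ℝ] Bdd S) (s : ℝ) (f : Bdd S) (x : S) :
    HasSum (fun n : ℕ => s ^ n / (n.factorial : ℝ) * ((A ^ n) f) x) (flow A s f x) :=
  (Bdd.eval x).hasSum (hasSum_flow A s f)

theorem semigroup_eq_flow {S : Type*} {𝒜 : (S → ℝ) → (S → ℝ)} {A : Bdd S →L[ℝ] Bdd S}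
    (h : ∀ f : Bdd S, 𝒜 f = A f) (t : ℝ≥0) (f : Bdd S) (x : S) :
    semigroup 𝒜 t f x = flow A t f x := by
  have hn : ∀ n : ℕ, 𝒜^[n] f = (A ^ n) f := by
    intro n
    induction n with
    | zero => simp
    | succ n ih => rw [Function.iterate_succ_apply', ih, h, pow_succ']; rfl
  unfold semigroup
  simp only [hn]
  exact (hasSum_flow_apply A t f x).tsum_eq

/-- The exponential of an operator `A` such that `A + c` preserves positivity preserves
positivity. -/
theorem flow_nonneg {S : Type*} {A : Bdd S →L[ℝ] Bdd S} {c : ℝ}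
    (hA : ∀ f : Bdd S, (∀ x, 0 ≤ f x) → ∀ x, 0 ≤ A f x + c * f x) {s : ℝ} (hs : 0 ≤ s)
    {f : Bdd S} (hf : ∀ x, 0 ≤ f x) (x : S) : Real.exp (-(s * c)) * f x ≤ flow A s f x := by
  have hn : ∀ n : ℕ, ∀ x, 0 ≤ ((A + c • (1 : Bdd S →L[ℝ] Bdd S)) ^ n) f x := by
    intro n
    induction n with
    | zero => simpa using hf
    | succ n ih => rw [pow_succ']; intro x; simpa using hA _ ih x
  have h := hasSum_flow_apply (A + c • (1 : Bdd S →L[ℝ] Bdd S)) s f x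
  rw [flow_add_smul_one] at h
  -- All terms of the series for `A + c` are non-negative, so the sum is at least the term `n = 0`.
  have h0 := le_hasSum h 0 fun n _ => mul_nonneg (by positivity) (hn n x)
  simp only [pow_zero, Nat.factorial_zero, Nat.cast_one, div_one, one_mul,
    one_apply_eq_self, smul_apply, Bdd.smul_apply] at h0
  rw [Real.exp_neg, inv_mul_le_iff₀ (Real.exp_pos _)]
  exact h0

/-! ### The killed chain -/

/-- Transition rates `Q` and death rates `p₀`, both non-negative, with total jump rates at most `q`
and death rates at most `p`. The row sums include the diagonal, which is to be set to zero first. -/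
structure RateBound {F : Type*} (Q : F → F → ℝ) (p₀ : F → ℝ) (q p : ℝ) : Prop where
  nonneg : ∀ i j, 0 ≤ Q i j
  summable : ∀ i, Summable (Q i)
  tsum_le : ∀ i, ∑' j, Q i j ≤ q
  death_nonneg : ∀ i, 0 ≤ p₀ i
  death_le : ∀ i, p₀ i ≤ p
  jump_nonneg : 0 ≤ q
  killing_nonneg : 0 ≤ p

theorem summable_mul_of_abs_le {ι : Type*} {w D : ι → ℝ} {M : ℝ} (hw : Summable w)
    (hw0 : ∀ j, 0 ≤ w j) (hD : ∀ j, |D j| ≤ M) : Summable fun j => w j * D j := by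
  refine Summable.of_norm_bounded (hw.mul_right M) fun j => ?_
  rw [Real.norm_eq_abs, abs_mul, abs_of_nonneg (hw0 j)]
  exact mul_le_mul_of_nonneg_left (hD j) (hw0 j)

theorem abs_tsum_mul_le {ι : Type*} {w D : ι → ℝ} {M : ℝ} (hw : Summable w)
    (hw0 : ∀ j, 0 ≤ w j) (hD : ∀ j, |D j| ≤ M) : |∑' j, w j * D j| ≤ M * ∑' j, w j := by
  rw [mul_comm, ← tsum_mul_right, ← Real.norm_eq_abs]
  refine tsum_of_norm_bounded (hw.mul_right M).hasSum fun j => ?_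
  rw [Real.norm_eq_abs, abs_mul, abs_of_nonneg (hw0 j)]
  exact mul_le_mul_of_nonneg_left (hD j) (hw0 j)

theorem abs_sub_le_two_mul_norm {S : Type*} (f : Bdd S) (x y : S) : |f x - f y| ≤ 2 * ‖f‖ := by
  have h1 := abs_apply_le_norm f x
  have h2 := abs_apply_le_norm f y
  rw [abs_le] at *
  constructor <;> linarith

section Killed

variable {F : Type*} {Q : F → F → ℝ} {p₀ : F → ℝ} {q p : ℝ}

namespace RateBound

theorem summable_mul_sub (h : RateBound Q p₀ q p) (f : Bdd F) (i : F) :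
    Summable fun j => Q i j * (f j - f i) :=
  summable_mul_of_abs_le (h.summable i) (h.nonneg i) fun j => abs_sub_le_two_mul_norm f j i

/-- The generator of the killed chain on bounded functions on `F*`, that is on functions vanishing
at the absorbing state. -/
def killedOp (h : RateBound Q p₀ q p) : Bdd F →L[ℝ] Bdd F :=
  Bdd.mkCLM (fun f i => -p₀ i * f i + ∑' j, Q i j * (f j - f i)) (p + 2 * q)
    (by have := h.jump_nonneg; have := h.killing_nonneg; positivity)
    (fun f i => by
      have h1 := abs_tsum_mul_le (h.summable i) (h.nonneg i)
        fun j => abs_sub_le_two_mul_norm f j i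
      have h2 : |-p₀ i * f i| ≤ p * ‖f‖ := by
        rw [abs_mul, abs_neg, abs_of_nonneg (h.death_nonneg i)]
        exact mul_le_mul (h.death_le i) (abs_apply_le_norm f i) (abs_nonneg _) h.killing_nonneg
      have h3 := mul_le_mul_of_nonneg_left (h.tsum_le i) (by positivity : 0 ≤ 2 * ‖f‖)
      refine (abs_add_le _ _).trans ?_
      linarith)
    (fun f g i => by
      have h1 := (h.summable_mul_sub f i).tsum_add (h.summable_mul_sub g i)
      have h2 : ∀ j, Q i j * ((f + g) j - (f + g) i)
          = Q i j * (f j - f i) + Q i j * (g j - g i) := fun j => by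
        simp only [Bdd.add_apply]; ring
      rw [tsum_congr h2, h1, Bdd.add_apply]
      ring)
    (fun c f i => by
      have h2 : ∀ j, Q i j * ((c • f) j - (c • f) i) = c * (Q i j * (f j - f i)) := fun j => by
        simp only [Bdd.smul_apply]; ring
      rw [tsum_congr h2, tsum_mul_left, Bdd.smul_apply]
      ring)

theorem killedOp_apply (h : RateBound Q p₀ q p) (f : Bdd F) (i : F) :
    h.killedOp f i = -p₀ i * f i + ∑' j, Q i j * (f j - f i) := rfl

theorem killedGenerator_extendZero (h : RateBound Q p₀ q p) (f : Bdd F) :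
    killedGenerator Q p₀ (extendZero f) = extendZero (h.killedOp f) := by
  funext x
  cases x with
  | none => rfl
  | some i =>
    simp only [killedGenerator, extendZero, killedOp_apply]
    ring

theorem semigroup_killedGenerator (h : RateBound Q p₀ q p) (t : ℝ≥0) (f : Bdd F) (i : F) :
    semigroup (killedGenerator Q p₀) t (extendZero f) (some i) = flow h.killedOp t f i := by
  have hn : ∀ n : ℕ, (killedGenerator Q p₀)^[n] (extendZero f)
      = extendZero ((h.killedOp ^ n) f) := by
    intro n
    induction n with
    | zero => simp
    | succ n ih =>
      rw [Function.iterate_succ_apply', ih, h.killedGenerator_extendZero, pow_succ']; rfl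
  unfold semigroup
  simp only [hn]
  exact (hasSum_flow_apply h.killedOp t f i).tsum_eq

theorem killedOp_add_nonneg (h : RateBound Q p₀ q p) (f : Bdd F) (hf : ∀ i, 0 ≤ f i) (i : F) :
    0 ≤ h.killedOp f i + (q + p) * f i := by
  have h1 : Summable fun j => Q i j * f j :=
    summable_mul_of_abs_le (h.summable i) (h.nonneg i) (abs_apply_le_norm f)
  have h2 : ∑' j, Q i j * (f j - f i) = ∑' j, Q i j * f j - (∑' j, Q i j) * f i := by
    rw [← tsum_mul_right, ← h1.tsum_sub ((h.summable i).mul_right _)]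
    exact tsum_congr fun j => by ring
  have h3 : 0 ≤ ∑' j, Q i j * f j := tsum_nonneg fun j => mul_nonneg (h.nonneg i j) (hf j)
  have h4 := mul_le_mul_of_nonneg_right (h.tsum_le i) (hf i)
  have h5 := mul_le_mul_of_nonneg_right (h.death_le i) (hf i)
  rw [killedOp_apply, h2]
  linarith

theorem flow_killedOp_nonneg (h : RateBound Q p₀ q p) {s : ℝ} (hs : 0 ≤ s) {f : Bdd F}
    (hf : ∀ i, 0 ≤ f i) (i : F) : 0 ≤ flow h.killedOp s f i :=
  (mul_nonneg (Real.exp_pos _).le (hf i)).trans (flow_nonneg h.killedOp_add_nonneg hs hf i)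

/-- The death rates, as a bounded function. -/
def death (h : RateBound Q p₀ q p) : Bdd F :=
  toBdd p₀ ⟨p, fun i => by rw [abs_of_nonneg (h.death_nonneg i)]; exact h.death_le i⟩

@[simp] theorem death_apply (h : RateBound Q p₀ q p) (i : F) : h.death i = p₀ i := rfl

/-- The death rates, affinely rescaled to take values in `[-1, 1]` (the constant `-1` if `p = 0`). -/
def centredDeath (h : RateBound Q p₀ q p) : Bdd F := (2 / p) • h.death - 1

theorem norm_centredDeath_le (h : RateBound Q p₀ q p) : ‖h.centredDeath‖ ≤ 1 := by
  refine Bdd.norm_le zero_le_one fun i => ?_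
  have h1 := div_nonneg (h.death_nonneg i) h.killing_nonneg
  have h2 := div_le_one_of_le₀ (h.death_le i) h.killing_nonneg
  have h3 : h.centredDeath i = 2 * (p₀ i / p) - 1 := by
    simp only [centredDeath, Bdd.sub_apply, Bdd.smul_apply, death_apply, Bdd.one_apply]
    ring
  rw [h3, abs_le]
  constructor <;> linarith

theorem death_eq (h : RateBound Q p₀ q p) : h.death = (p / 2) • (h.centredDeath + 1) := by
  refine Bdd.ext' fun i => ?_
  simp only [centredDeath, Bdd.sub_apply, Bdd.smul_apply, Bdd.add_apply, death_apply,
    Bdd.one_apply]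
  rcases h.killing_nonneg.eq_or_lt with hp | hp
  · have := h.death_nonneg i
    have := h.death_le i
    rw [← hp] at this ⊢
    linarith
  · field_simp
    ring

theorem killedOp_one (h : RateBound Q p₀ q p) : h.killedOp 1 = -h.death := by
  refine Bdd.ext' fun i => ?_
  rw [killedOp_apply, lp.coeFn_neg]
  simp

theorem abs_flow_killedOp_le (h : RateBound Q p₀ q p) {s : ℝ} (hs : 0 ≤ s) (f : Bdd F) (i : F) :
    |flow h.killedOp s f i| ≤ ‖f‖ * flow h.killedOp s 1 i := by
  have hf := fun j => abs_le.1 (abs_apply_le_norm f j)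
  have h1 := h.flow_killedOp_nonneg hs (f := ‖f‖ • 1 - f)
    (fun j => by simpa using (hf j).2) i
  have h2 := h.flow_killedOp_nonneg hs (f := ‖f‖ • 1 + f)
    (fun j => by simpa [neg_le_iff_add_nonneg'] using (hf j).1) i
  simp only [map_sub, map_add, map_smul, Bdd.sub_apply, Bdd.add_apply, Bdd.smul_apply] at h1 h2
  rw [abs_le]
  constructor <;> linarith

/-- The survival probability is at most one, since its time derivative is `-P_s p₀ ≤ 0`. -/
theorem flow_killedOp_one_le (h : RateBound Q p₀ q p) {s : ℝ} (hs : 0 ≤ s) (i : F) :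
    flow h.killedOp s 1 i ≤ 1 := by
  have hd : ∀ r : ℝ, HasDerivAt (fun r => flow h.killedOp r 1 i)
      (-(flow h.killedOp r h.death i)) r := by
    intro r
    have h1 := (Bdd.eval i).hasFDerivAt.comp_hasDerivAt r
      ((hasDerivAt_flow h.killedOp r).clm_apply (hasDerivAt_const r (1 : Bdd F)))
    refine h1.congr_deriv ?_
    rw [map_zero, add_zero, mul_apply_eq_comp, killedOp_one, map_neg, map_neg]
    rfl
  have h2 := image_le_of_deriv_right_le_deriv_boundary (a := 0) (b := s)
    (fun r _ => (hd r).continuousAt.continuousWithinAt) (fun r _ => (hd r).hasDerivWithinAt)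
    (B := fun _ => 1) (B' := fun _ => 0) (by simp [flow_zero]) continuousOn_const
    (fun r _ => hasDerivWithinAt_const _ _ _)
    (fun r hr => neg_nonpos.2 (h.flow_killedOp_nonneg hr.1 h.death_nonneg i))
  exact h2 ⟨hs, le_rfl⟩

theorem norm_flow_killedOp_le (h : RateBound Q p₀ q p) {s : ℝ} (hs : 0 ≤ s) (f : Bdd F) :
    ‖flow h.killedOp s f‖ ≤ ‖f‖ :=
  Bdd.norm_le (norm_nonneg _) fun i => (h.abs_flow_killedOp_le hs f i).trans
    (mul_le_of_le_one_right (norm_nonneg _) (h.flow_killedOp_one_le hs i))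

end RateBound

end Killed

/-! ### The conditioned law -/

section Conditioned

variable {F : Type*} [MeasurableSpace F] [DiscreteMeasurableSpace F]
  {Q : F → F → ℝ} {p₀ : F → ℝ} {q p : ℝ}

theorem Bdd.integrable (μ : Measure F) [IsProbabilityMeasure μ] [Countable F] (f : Bdd F) :
    Integrable f μ :=
  Integrable.of_bound (Measurable.of_discrete (f := ⇑f)).aestronglyMeasurable ‖f‖
    (Filter.Eventually.of_forall fun x => abs_apply_le_norm f x)

/-- Integration against a probability measure, as a continuous linear functional. -/
def integralCLM (μ : Measure F) [IsProbabilityMeasure μ] [Countable F] : Bdd F →L[ℝ] ℝ :=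
  LinearMap.mkContinuous
    { toFun := fun f => ∫ x, f x ∂μ
      map_add' := fun f g => by
        simp only [Bdd.add_apply]
        exact integral_add (Bdd.integrable μ f) (Bdd.integrable μ g)
      map_smul' := fun c f => by
        simp only [Bdd.smul_apply]
        exact integral_const_mul _ _ } 1
    fun f => by
      have := norm_integral_le_of_norm_le_const (μ := μ)
        (f := ⇑f) (Filter.Eventually.of_forall fun x => abs_apply_le_norm f x)
      simpa using this

theorem integralCLM_apply (μ : Measure F) [IsProbabilityMeasure μ] [Countable F] (f : Bdd F) :
    integralCLM μ f = ∫ x, f x ∂μ := rfl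

theorem integralCLM_mono (μ : Measure F) [IsProbabilityMeasure μ] [Countable F] {f g : Bdd F}
    (h : ∀ x, f x ≤ g x) : integralCLM μ f ≤ integralCLM μ g :=
  integral_mono (Bdd.integrable μ f) (Bdd.integrable μ g) h

theorem integralCLM_one (μ : Measure F) [IsProbabilityMeasure μ] [Countable F] :
    integralCLM μ 1 = 1 := by
  simp [integralCLM_apply]

namespace RateBound

variable [Countable F] (h : RateBound Q p₀ q p) (μ : Measure F) [IsProbabilityMeasure μ]

/-- The conditioned law `v_s(f) = μ P_s f / μ P_s 1`, on bounded functions. -/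
def condLaw (h : RateBound Q p₀ q p) (μ : Measure F) [IsProbabilityMeasure μ] (s : ℝ)
    (f : Bdd F) : ℝ :=
  integralCLM μ (flow h.killedOp s f) / integralCLM μ (flow h.killedOp s 1)

theorem survival_pos {s : ℝ} (hs : 0 ≤ s) : 0 < integralCLM μ (flow h.killedOp s 1) := by
  refine (Real.exp_pos (-(s * (q + p)))).trans_le ?_
  have h1 := integralCLM_mono μ (f := Real.exp (-(s * (q + p))) • 1)
    (g := flow h.killedOp s 1) fun i => by
      simpa using flow_nonneg h.killedOp_add_nonneg hs (f := 1) (fun j => by simp) i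
  simpa [integralCLM_one] using h1

theorem abs_condLaw_le {s : ℝ} (hs : 0 ≤ s) (f : Bdd F) : |h.condLaw μ s f| ≤ ‖f‖ := by
  have h0 := h.survival_pos μ hs
  rw [condLaw, abs_div, abs_of_pos h0, div_le_iff₀ h0, abs_le]
  have hi := fun i => abs_le.1 (h.abs_flow_killedOp_le hs f i)
  have h1 := integralCLM_mono μ (f := flow h.killedOp s f) (g := ‖f‖ • flow h.killedOp s 1)
    fun i => by simpa using (hi i).2
  have h2 := integralCLM_mono μ (f := (-‖f‖) • flow h.killedOp s 1) (g := flow h.killedOp s f)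
    fun i => by rw [Bdd.smul_apply, neg_mul]; exact (hi i).1
  simp only [map_smul, smul_eq_mul] at h1 h2
  constructor <;> linarith

theorem condLaw_one {s : ℝ} (hs : 0 ≤ s) : h.condLaw μ s 1 = 1 :=
  div_self (h.survival_pos μ hs).ne'

theorem condLaw_sub (s : ℝ) (f g : Bdd F) :
    h.condLaw μ s (f - g) = h.condLaw μ s f - h.condLaw μ s g := by
  simp only [condLaw, map_sub, sub_div]

theorem condLaw_smul (s c : ℝ) (f : Bdd F) : h.condLaw μ s (c • f) = c * h.condLaw μ s f := by
  simp only [condLaw, map_smul, smul_eq_mul, mul_div_assoc]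

theorem condLaw_zero (f : Bdd F) : h.condLaw μ 0 f = integralCLM μ f := by
  simp [condLaw, flow_zero, integralCLM_one]

theorem condLaw_death_le {s : ℝ} (hs : 0 ≤ s) : h.condLaw μ s h.death ≤ p :=
  (le_abs_self _).trans ((h.abs_condLaw_le μ hs _).trans
    (Bdd.norm_le h.killing_nonneg fun i => by
      rw [death_apply, abs_of_nonneg (h.death_nonneg i)]; exact h.death_le i))

/-- Along the backward evolution `s ↦ P_{T-s} φ` the numerator of `v_s` is constant, so only the
normalisation `μ P_s 1` contributes to the derivative. -/
theorem hasDerivAt_condLaw_backward (T : ℝ) (φ : Bdd F) {s : ℝ} (hs : 0 ≤ s) :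
    HasDerivAt (fun r => h.condLaw μ r (flow h.killedOp (T - r) φ))
      (h.condLaw μ s (flow h.killedOp (T - s) φ) * h.condLaw μ s h.death) s := by
  have hc : ∀ r, flow h.killedOp r (flow h.killedOp (T - r) φ) = flow h.killedOp T φ := by
    intro r
    have := flow_add h.killedOp r (T - r)
    rw [add_sub_cancel] at this
    rw [this]; rfl
  have hd : HasDerivAt (fun r => integralCLM μ (flow h.killedOp r 1))
      (-integralCLM μ (flow h.killedOp s h.death)) s := by
    have h1 := (integralCLM μ).hasFDerivAt.comp_hasDerivAt s
      ((hasDerivAt_flow h.killedOp s).clm_apply (hasDerivAt_const s (1 : Bdd F)))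
    refine h1.congr_deriv ?_
    rw [map_zero, add_zero, mul_apply_eq_comp, killedOp_one, map_neg, map_neg]
  have h0 := (h.survival_pos μ hs).ne'
  have h1 := (hasDerivAt_const s (integralCLM μ (flow h.killedOp T φ))).div hd h0
  have h2 : (fun r => h.condLaw μ r (flow h.killedOp (T - r) φ))
      = (fun _ => integralCLM μ (flow h.killedOp T φ))
        / fun r => integralCLM μ (flow h.killedOp r 1) := by
    funext r
    simp only [condLaw, hc, Pi.div_apply]
  rw [h2]
  refine h1.congr_deriv ?_
  rw [condLaw, condLaw, hc]
  field_simp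
  ring

theorem conditionedLaw_eq (t : ℝ≥0) (f : Bdd F) :
    conditionedLaw Q p₀ μ t f = h.condLaw μ t f := by
  have h1 : (fun _ => 1 : F → ℝ) = (1 : Bdd F) := by
    funext x; simp
  unfold conditionedLaw killedLaw
  rw [h1]
  simp only [h.semigroup_killedGenerator]
  rfl

end RateBound

end Conditioned

/-! ### The particle system -/

section Particles

variable {F : Type*} {N : ℕ}

theorem Config.sum_cast (η : Config F N) : ∑ i ∈ η.1.support, (η.1 i : ℝ) = N := by
  exact_mod_cast congrArg (Nat.cast : ℕ → ℝ) η.2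

theorem Config.abs_sum_mul_le (η : Config F N) {g : F → ℝ} {M : ℝ} (hg : ∀ i, |g i| ≤ M) :
    |∑ i ∈ η.1.support, (η.1 i : ℝ) * g i| ≤ N * M := by
  rw [← η.sum_cast, Finset.sum_mul]
  refine (Finset.abs_sum_le_sum_abs _ _).trans (Finset.sum_le_sum fun i _ => ?_)
  rw [abs_mul, Nat.abs_cast]
  exact mul_le_mul_of_nonneg_left (hg i) (Nat.cast_nonneg _)

/-- The map `ψ ↦ (η ↦ m(η)(ψ))`, where `m(η)` is the empirical distribution. -/
def empiricalOp (F : Type*) (N : ℕ) : Bdd F →L[ℝ] Bdd (Config F N) :=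
  Bdd.mkCLM (fun ψ η => (N : ℝ)⁻¹ * ∑ i ∈ η.1.support, (η.1 i : ℝ) * ψ i) 1 zero_le_one
    (fun ψ η => by
      rw [abs_mul, abs_of_nonneg (by positivity : (0 : ℝ) ≤ (N : ℝ)⁻¹), one_mul]
      refine (mul_le_mul_of_nonneg_left (η.abs_sum_mul_le (abs_apply_le_norm ψ))
        (by positivity)).trans ?_
      rw [← mul_assoc]
      exact mul_le_of_le_one_left (norm_nonneg _) (inv_mul_le_one))
    (fun ψ χ η => by
      simp only [Bdd.add_apply, mul_add, Finset.sum_add_distrib])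
    (fun c ψ η => by
      simp only [Bdd.smul_apply, Finset.mul_sum]
      exact Finset.sum_congr rfl fun i _ => by ring)

theorem empiricalOp_apply (ψ : Bdd F) (η : Config F N) :
    empiricalOp F N ψ η = (N : ℝ)⁻¹ * ∑ i ∈ η.1.support, (η.1 i : ℝ) * ψ i := rfl

theorem Config.sum_mul (hN : 2 ≤ N) (ψ : Bdd F) (η : Config F N) :
    ∑ i ∈ η.1.support, (η.1 i : ℝ) * ψ i = N * empiricalOp F N ψ η := by
  have : (N : ℝ) ≠ 0 := by positivity
  rw [empiricalOp_apply, mul_inv_cancel_left₀ this]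

theorem abs_empiricalOp_le (ψ : Bdd F) (η : Config F N) : |empiricalOp F N ψ η| ≤ ‖ψ‖ := by
  rw [empiricalOp_apply, abs_mul, abs_of_nonneg (by positivity : (0 : ℝ) ≤ (N : ℝ)⁻¹)]
  refine (mul_le_mul_of_nonneg_left (η.abs_sum_mul_le (abs_apply_le_norm ψ))
    (by positivity)).trans ?_
  rw [← mul_assoc]
  exact mul_le_of_le_one_left (norm_nonneg _) (inv_mul_le_one)

theorem empiricalOp_one (hN : 2 ≤ N) (η : Config F N) : empiricalOp F N 1 η = 1 := by
  have : (N : ℝ) ≠ 0 := by positivity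
  rw [empiricalOp_apply]
  simp [η.sum_cast, this]

theorem empiricalOp_move (ψ : Bdd F) (η : Config F N) {i : F} (hi : η.1 i ≠ 0) (j : F) :
    empiricalOp F N ψ (move η i j) = empiricalOp F N ψ η + (N : ℝ)⁻¹ * (ψ j - ψ i) := by
  have hadd : ∀ ξ ζ : F →₀ ℕ, (ξ + ζ).sum (fun k n => (n : ℝ) * ψ k)
      = ξ.sum (fun k n => (n : ℝ) * ψ k) + ζ.sum (fun k n => (n : ℝ) * ψ k) := fun ξ ζ =>
    Finsupp.sum_add_index' (by simp) (by intros; push_cast; ring)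
  have hsingle : ∀ k, (Finsupp.single k 1 : F →₀ ℕ).sum (fun k n => (n : ℝ) * ψ k) = ψ k :=
    fun k => by rw [Finsupp.sum_single_index] <;> simp
  have hle : Finsupp.single i 1 ≤ η.1 := by
    rw [Finsupp.single_le_iff]; omega
  have h1 := hadd (η.1 - Finsupp.single i 1) (Finsupp.single i 1)
  rw [tsub_add_cancel_of_le hle, hsingle] at h1
  have h2 := hadd (η.1 - Finsupp.single i 1) (Finsupp.single j 1)
  rw [hsingle] at h2
  have h3 : (move η i j).1 = η.1 - Finsupp.single i 1 + Finsupp.single j 1 :=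
    congrArg Subtype.val (dif_pos hi)
  rw [empiricalOp_apply, empiricalOp_apply, ← mul_add]
  congr 1
  change (move η i j).1.sum (fun k n => (n : ℝ) * ψ k)
    = η.1.sum (fun k n => (n : ℝ) * ψ k) + _
  rw [h3, h1, h2]
  ring

variable {Q : F → F → ℝ} {p₀ : F → ℝ} {q p : ℝ}

/-- The rate at which a particle at `i` jumps to `j` in the configuration `η`. -/
def particleRate (Q : F → F → ℝ) (p₀ : F → ℝ) (η : Config F N) (i j : F) : ℝ :=
  Q i j + p₀ i * ((η.1 j : ℝ) / ((N : ℝ) - 1))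

theorem one_le_sub_one (hN : 2 ≤ N) : (1 : ℝ) ≤ (N : ℝ) - 1 := by
  have : (2 : ℝ) ≤ N := by exact_mod_cast hN
  linarith

namespace RateBound

variable (h : RateBound Q p₀ q p)
include h

theorem particleRate_nonneg (hN : 2 ≤ N) (η : Config F N) (i j : F) :
    0 ≤ particleRate Q p₀ η i j := by
  have h1 := one_le_sub_one hN
  exact add_nonneg (h.nonneg i j)
    (mul_nonneg (h.death_nonneg i) (div_nonneg (Nat.cast_nonneg _) (by linarith)))

theorem hasSum_particleRate_mul (η : Config F N) (i : F) {D : F → ℝ} {M : ℝ}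
    (hD : ∀ j, |D j| ≤ M) :
    HasSum (fun j => particleRate Q p₀ η i j * D j)
      (∑' j, Q i j * D j + p₀ i / ((N : ℝ) - 1) * ∑ j ∈ η.1.support, (η.1 j : ℝ) * D j) := by
  have h1 := (summable_mul_of_abs_le (h.summable i) (h.nonneg i) hD).hasSum
  have h2 : HasSum (fun j => (η.1 j : ℝ) * D j) (∑ j ∈ η.1.support, (η.1 j : ℝ) * D j) :=
    hasSum_sum_of_ne_finset_zero fun j hj => by
      rw [Finsupp.notMem_support_iff.1 hj]; simp
  convert h1.add (h2.mul_left (p₀ i / ((N : ℝ) - 1))) using 2 with j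
  rw [particleRate]
  ring

theorem summable_particleRate (η : Config F N) (i : F) : Summable (particleRate Q p₀ η i) := by
  simpa using (h.hasSum_particleRate_mul η i (D := fun _ => 1) (M := 1) (by simp)).summable

theorem tsum_particleRate_le (hN : 2 ≤ N) (η : Config F N) (i : F) :
    ∑' j, particleRate Q p₀ η i j ≤ q + 2 * p := by
  have h1 := (h.hasSum_particleRate_mul η i (D := fun _ => 1) (M := 1) (by simp)).tsum_eq
  simp only [mul_one, η.sum_cast] at h1
  have h2 := one_le_sub_one hN
  have h3 : p₀ i / ((N : ℝ) - 1) * N ≤ 2 * p := by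
    rw [div_mul_eq_mul_div, div_le_iff₀ (by linarith)]
    nlinarith [h.death_nonneg i, h.death_le i]
  rw [h1]
  exact add_le_add (h.tsum_le i) h3

theorem summable_particleRate_mul_sub (hN : 2 ≤ N) (f : Bdd (Config F N)) (η : Config F N)
    (i : F) : Summable fun j => particleRate Q p₀ η i j * (f (move η i j) - f η) :=
  summable_mul_of_abs_le (h.summable_particleRate η i) (h.particleRate_nonneg hN η i)
    fun j => abs_sub_le_two_mul_norm f (move η i j) η

omit h in
theorem particleGenerator_eq (f : Config F N → ℝ) (η : Config F N) :
    particleGenerator Q p₀ f η = ∑ i ∈ η.1.support, (η.1 i : ℝ) *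
      ∑' j, particleRate Q p₀ η i j * (f (move η i j) - f η) := by
  simp only [particleGenerator, particleRate, mul_comm]

/-- The generator of the particle system, as a bounded operator. -/
def particleOp (h : RateBound Q p₀ q p) (hN : 2 ≤ N) :
    Bdd (Config F N) →L[ℝ] Bdd (Config F N) :=
  Bdd.mkCLM (fun f => particleGenerator Q p₀ f) (N * (2 * (q + 2 * p)))
    (by have := h.jump_nonneg; have := h.killing_nonneg; positivity)
    (fun f η => by
      rw [particleGenerator_eq, mul_assoc]
      refine η.abs_sum_mul_le fun i => ?_
      have h1 := abs_tsum_mul_le (h.summable_particleRate η i) (h.particleRate_nonneg hN η i)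
        fun j => abs_sub_le_two_mul_norm f (move η i j) η
      have h2 := mul_le_mul_of_nonneg_left (h.tsum_particleRate_le hN η i)
        (by positivity : 0 ≤ 2 * ‖f‖)
      linarith)
    (fun f g η => by
      simp only [particleGenerator_eq]
      rw [← Finset.sum_add_distrib]
      refine Finset.sum_congr rfl fun i _ => ?_
      rw [← mul_add, ← (h.summable_particleRate_mul_sub hN f η i).tsum_add
        (h.summable_particleRate_mul_sub hN g η i)]
      congr 1
      exact tsum_congr fun j => by simp only [Bdd.add_apply]; ring)
    (fun c f η => by
      simp only [particleGenerator_eq]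
      rw [Finset.mul_sum]
      refine Finset.sum_congr rfl fun i _ => ?_
      rw [mul_left_comm c]
      congr 1
      rw [← tsum_mul_left]
      exact tsum_congr fun j => by simp only [Bdd.smul_apply]; ring)

theorem particleOp_apply (hN : 2 ≤ N) (f : Bdd (Config F N)) (η : Config F N) :
    h.particleOp hN f η = ∑ i ∈ η.1.support, (η.1 i : ℝ) *
      ∑' j, particleRate Q p₀ η i j * (f (move η i j) - f η) :=
  particleGenerator_eq (f : Config F N → ℝ) η

/-- The generator on the square of `m(η)(ψ) - w`. The first term is the drift of the killed chain
together with the resampling of killed particles; the error of order `1 / N` is made of the carré du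
champ and of the fact that a killed particle does not jump onto itself. -/
theorem particleOp_sq_le (hN : 2 ≤ N) {ψ : Bdd F} (hψ : ‖ψ‖ ≤ 1) {w : ℝ} (hw : |w| ≤ 1)
    (η : Config F N) :
    h.particleOp hN ((empiricalOp F N ψ - w • 1) * (empiricalOp F N ψ - w • 1)) η
      ≤ 2 * (empiricalOp F N ψ η - w) * (empiricalOp F N (h.killedOp ψ) η
          + empiricalOp F N h.death η * empiricalOp F N ψ η) + (4 * q + 24 * p) / N := by
  set X := empiricalOp F N ψ η - w with hX
  have hN1 := one_le_sub_one hN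
  have hN0 : (0 : ℝ) < N := by linarith
  have hq := h.jump_nonneg
  have hp := h.killing_nonneg
  set m := empiricalOp F N ψ η with hm
  set a := empiricalOp F N h.death η with ha
  set b := empiricalOp F N (h.death * ψ) η with hb
  have hd : ∀ i j, |(N : ℝ)⁻¹ * (ψ j - ψ i)| ≤ 2 / N := fun i j => by
    rw [abs_mul, abs_of_nonneg (by positivity : (0 : ℝ) ≤ (N : ℝ)⁻¹), inv_mul_eq_div]
    have := abs_sub_le_two_mul_norm ψ j i
    gcongr
    linarith
  have hd2 : ∀ i j, |((N : ℝ)⁻¹ * (ψ j - ψ i)) ^ 2| ≤ (2 / N) ^ 2 := fun i j => by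
    rw [abs_pow]
    exact pow_le_pow_left₀ (abs_nonneg _) (hd i j) 2
  -- For a jump from `i` to `j` the square changes by `2 X δ + δ ^ 2`, where
  -- `δ = N⁻¹ * (ψ j - ψ i)`; the terms `δ ^ 2` make up the carré du champ.
  have hterm : ∀ i ∈ η.1.support,
      (η.1 i : ℝ) * ∑' j, particleRate Q p₀ η i j *
        (((empiricalOp F N ψ - w • 1) * (empiricalOp F N ψ - w • 1)) (move η i j)
          - ((empiricalOp F N ψ - w • 1) * (empiricalOp F N ψ - w • 1)) η)
      ≤ (η.1 i : ℝ) * (2 * X * (N : ℝ)⁻¹ * (h.killedOp ψ i + (h.death * ψ) i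
          + N / ((N : ℝ) - 1) * (m * h.death i - (h.death * ψ) i)) + (2 / N) ^ 2 * (q + 2 * p)) := by
    intro i hi
    refine mul_le_mul_of_nonneg_left ?_ (Nat.cast_nonneg _)
    have h1 := h.hasSum_particleRate_mul η i (hd i)
    have h2 := (summable_mul_of_abs_le (h.summable_particleRate η i)
      (h.particleRate_nonneg hN η i) (hd2 i)).hasSum
    have h3 := (le_abs_self _).trans (abs_tsum_mul_le (h.summable_particleRate η i)
      (h.particleRate_nonneg hN η i) (hd2 i))
    have h4 := (h1.mul_left (2 * X)).add h2
    have h5 : ∀ j, particleRate Q p₀ η i j *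
        (((empiricalOp F N ψ - w • 1) * (empiricalOp F N ψ - w • 1)) (move η i j)
          - ((empiricalOp F N ψ - w • 1) * (empiricalOp F N ψ - w • 1)) η)
        = 2 * X * (particleRate Q p₀ η i j * ((N : ℝ)⁻¹ * (ψ j - ψ i)))
          + particleRate Q p₀ η i j * ((N : ℝ)⁻¹ * (ψ j - ψ i)) ^ 2 := fun j => by
      simp only [Bdd.mul_apply, Bdd.sub_apply, Bdd.smul_apply, Bdd.one_apply,
        empiricalOp_move ψ η (Finsupp.mem_support_iff.1 hi) j, hX, hm]
      ring
    rw [tsum_congr h5, h4.tsum_eq]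
    have h6 : ∑ j ∈ η.1.support, (η.1 j : ℝ) * ((N : ℝ)⁻¹ * (ψ j - ψ i)) = m - ψ i := by
      have : ∀ j ∈ η.1.support, (η.1 j : ℝ) * ((N : ℝ)⁻¹ * (ψ j - ψ i))
          = (N : ℝ)⁻¹ * ((η.1 j : ℝ) * ψ j) - (N : ℝ)⁻¹ * ψ i * (η.1 j : ℝ) := fun j _ => by ring
      rw [Finset.sum_congr rfl this, Finset.sum_sub_distrib, ← Finset.mul_sum, ← Finset.mul_sum,
        η.sum_cast, η.sum_mul hN, inv_mul_cancel_left₀ hN0.ne', ← hm]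
      field_simp
    have h7 : ∑' j, Q i j * ((N : ℝ)⁻¹ * (ψ j - ψ i))
        = (N : ℝ)⁻¹ * (h.killedOp ψ i + (h.death * ψ) i) := by
      simp only [mul_left_comm (Q i _), tsum_mul_left]
      rw [killedOp_apply, Bdd.mul_apply, death_apply]
      ring
    rw [h6, h7]
    have h8 := mul_le_mul_of_nonneg_left (h.tsum_particleRate_le hN η i)
      (by positivity : (0 : ℝ) ≤ (2 / N) ^ 2)
    have h9 : 2 * X * ((N : ℝ)⁻¹ * (h.killedOp ψ i + (h.death * ψ) i)
        + p₀ i / ((N : ℝ) - 1) * (m - ψ i))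
        = 2 * X * (N : ℝ)⁻¹ * (h.killedOp ψ i + (h.death * ψ) i
          + N / ((N : ℝ) - 1) * (m * h.death i - (h.death * ψ) i)) := by
      rw [Bdd.mul_apply, death_apply]
      have : (N : ℝ) - 1 ≠ 0 := by linarith
      field_simp
    rw [h9]
    linarith
  rw [h.particleOp_apply hN]
  refine (Finset.sum_le_sum hterm).trans ?_
  have hsum : ∑ i ∈ η.1.support, (η.1 i : ℝ) * (2 * X * (N : ℝ)⁻¹ * (h.killedOp ψ i
      + (h.death * ψ) i + N / ((N : ℝ) - 1) * (m * h.death i - (h.death * ψ) i))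
        + (2 / N) ^ 2 * (q + 2 * p))
      = 2 * X * (empiricalOp F N (h.killedOp ψ) η + b + N / ((N : ℝ) - 1) * (m * a - b))
        + 4 * (q + 2 * p) / N := by
    have : ∀ i ∈ η.1.support, (η.1 i : ℝ) * (2 * X * (N : ℝ)⁻¹ * (h.killedOp ψ i
        + (h.death * ψ) i + N / ((N : ℝ) - 1) * (m * h.death i - (h.death * ψ) i))
          + (2 / N) ^ 2 * (q + 2 * p))
        = 2 * X * (N : ℝ)⁻¹ * ((η.1 i : ℝ) * h.killedOp ψ i)
          + 2 * X * (N : ℝ)⁻¹ * (1 - N / ((N : ℝ) - 1)) * ((η.1 i : ℝ) * (h.death * ψ) i)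
          + 2 * X * (N : ℝ)⁻¹ * (N / ((N : ℝ) - 1) * m) * ((η.1 i : ℝ) * h.death i)
          + (2 / N) ^ 2 * (q + 2 * p) * (η.1 i : ℝ) := fun i _ => by ring
    rw [Finset.sum_congr rfl this]
    simp only [Finset.sum_add_distrib, ← Finset.mul_sum, η.sum_cast, η.sum_mul hN]
    rw [← ha, ← hb]
    field_simp
    ring
  rw [hsum]
  have hm1 : |m| ≤ 1 := (abs_empiricalOp_le ψ η).trans hψ
  have hX2 : |X| ≤ 2 := (abs_sub _ _).trans (by linarith)
  have hdn : ‖h.death‖ ≤ p := Bdd.norm_le hp fun i => by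
    rw [death_apply, abs_of_nonneg (h.death_nonneg i)]; exact h.death_le i
  have ha1 : |a| ≤ p := (abs_empiricalOp_le _ η).trans hdn
  have hb1 : |b| ≤ p := (abs_empiricalOp_le _ η).trans
    ((norm_mul_le _ _).trans (by nlinarith [norm_nonneg ψ]))
  have hbias : |m * a - b| ≤ 2 * p := by
    refine (abs_sub _ _).trans ?_
    rw [abs_mul]
    nlinarith [abs_nonneg m, abs_nonneg a]
  have hXb : X * (m * a - b) ≤ 4 * p := by
    refine (le_abs_self _).trans ?_
    rw [abs_mul]
    nlinarith [abs_nonneg X, abs_nonneg (m * a - b)]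
  have hNN : 1 / ((N : ℝ) - 1) ≤ 2 / N := by
    rw [div_le_div_iff₀ (by linarith) hN0]; linarith
  -- The excess of `N / (N - 1)` over `1` in the resampling term is the price of the exclusion of
  -- self-jumps.
  have hfin : 2 * (X * (m * a - b)) * (1 / ((N : ℝ) - 1)) ≤ 16 * p / N := by
    calc 2 * (X * (m * a - b)) * (1 / ((N : ℝ) - 1))
        ≤ 2 * (4 * p) * (1 / ((N : ℝ) - 1)) := by
          refine mul_le_mul_of_nonneg_right (by linarith) ?_
          exact div_nonneg zero_le_one (by linarith)
      _ ≤ 2 * (4 * p) * (2 / N) := mul_le_mul_of_nonneg_left hNN (by linarith)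
      _ = 16 * p / N := by ring
  have hfrac : (N : ℝ) / ((N : ℝ) - 1) = 1 + 1 / ((N : ℝ) - 1) := by
    have : (N : ℝ) - 1 ≠ 0 := by linarith
    field_simp
    ring
  rw [hfrac]
  have e1 : (4 * q + 24 * p) / (N : ℝ) = 16 * p / N + 4 * (q + 2 * p) / N := by ring
  rw [e1]
  linarith

end RateBound

end Particles

/-! ### The mean square deviation -/

section Deviation

variable {F : Type*} [Countable F] [MeasurableSpace F] [DiscreteMeasurableSpace F] {N : ℕ}
  {Q : F → F → ℝ} {p₀ : F → ℝ} {q p : ℝ}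

namespace RateBound

/-- The deviation `η ↦ m(η)(f) - v_s(f)` of the empirical mean from the conditioned law. -/
def deviation (h : RateBound Q p₀ q p) (N : ℕ) (μ : Measure F) [IsProbabilityMeasure μ] (s : ℝ)
    (f : Bdd F) : Bdd (Config F N) :=
  empiricalOp F N f - h.condLaw μ s f • 1

variable (h : RateBound Q p₀ q p) (μ : Measure F) [IsProbabilityMeasure μ]

theorem deviation_apply (s : ℝ) (f : Bdd F) (η : Config F N) :
    h.deviation N μ s f η = empiricalOp F N f η - h.condLaw μ s f := by
  simp [deviation]

theorem abs_deviation_le {s : ℝ} (hs : 0 ≤ s) {f : Bdd F} (hf : ‖f‖ ≤ 1) (η : Config F N) :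
    |h.deviation N μ s f η| ≤ 2 := by
  rw [deviation_apply]
  have h1 := abs_empiricalOp_le f η
  have h2 := h.abs_condLaw_le μ hs f
  exact (abs_sub _ _).trans (by linarith)

theorem deviation_death (hN : 2 ≤ N) {s : ℝ} (hs : 0 ≤ s) (η : Config F N) :
    h.deviation N μ s h.death η = p / 2 * h.deviation N μ s h.centredDeath η := by
  have h1 : h.death = (p / 2) • (h.centredDeath - (-1 : ℝ) • 1) := by
    rw [neg_one_smul, sub_neg_eq_add]; exact h.death_eq
  rw [deviation_apply, deviation_apply, h1, condLaw_smul, condLaw_sub, condLaw_smul,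
    h.condLaw_one μ hs]
  simp only [map_smul, map_sub, Bdd.smul_apply, Bdd.sub_apply, empiricalOp_one hN]
  ring

/-- The killing part of the drift is quadratic in the laws; its difference between the two systems
is controlled by the mean square deviations of the test function and of the death rate. -/
theorem particleOp_deviation_sq_add_le (hN : 2 ≤ N) {s : ℝ} (hs : 0 ≤ s) {ψ : Bdd F}
    (hψ : ‖ψ‖ ≤ 1) (η : Config F N) :
    h.particleOp hN (h.deviation N μ s ψ * h.deviation N μ s ψ) η
        + 2 * h.deviation N μ s ψ η * (-empiricalOp F N (h.killedOp ψ) η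
          - h.condLaw μ s ψ * h.condLaw μ s h.death)
      ≤ 5 * p / 2 * h.deviation N μ s ψ η ^ 2 + p / 2 * h.deviation N μ s h.centredDeath η ^ 2
        + (4 * q + 24 * p) / N := by
  have h1 := h.particleOp_sq_le hN hψ ((h.abs_condLaw_le μ hs ψ).trans hψ) η
  have hY := h.deviation_death μ hN hs η
  have hp := h.killing_nonneg
  have hv := h.condLaw_death_le μ hs
  have hm : |empiricalOp F N ψ η| ≤ 1 := (abs_empiricalOp_le ψ η).trans hψ
  rw [deviation_apply] at hY
  rw [← deviation_apply] at h1
  change h.particleOp hN (h.deviation N μ s ψ * h.deviation N μ s ψ) η ≤ _ at h1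
  have hX := h.deviation_apply μ s ψ η
  set X := h.deviation N μ s ψ η
  set Z := h.deviation N μ s h.centredDeath η
  set m := empiricalOp F N ψ η
  set w := h.condLaw μ s ψ
  set a := empiricalOp F N h.death η
  set v := h.condLaw μ s h.death
  have h2 : 2 * X * (a * m - w * v) = p * (X * Z * m) + 2 * v * X ^ 2 := by
    have ha : a = v + p / 2 * Z := by linarith
    have hw : w = m - X := by linarith
    rw [ha, hw]; ring
  have h3 : X * Z * m ≤ (X ^ 2 + Z ^ 2) / 2 := by
    have e1 : X * Z * m ≤ |X * Z| := by
      refine (le_abs_self _).trans ?_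
      rw [abs_mul]
      exact mul_le_of_le_one_right (abs_nonneg _) hm
    have e2 : |X * Z| ≤ (X ^ 2 + Z ^ 2) / 2 := by
      rw [abs_le]
      constructor <;> nlinarith [sq_nonneg (X + Z), sq_nonneg (X - Z)]
    exact e1.trans e2
  have h4 := mul_le_mul_of_nonneg_left h3 hp
  have h5 := mul_le_mul_of_nonneg_right hv (sq_nonneg X)
  linarith

/-- The time derivative of the mean square deviation along the backward evolution. -/
theorem hasDerivAt_meanSquare (hN : 2 ≤ N) (η₀ : Config F N) (T : ℝ) (φ : Bdd F) {s : ℝ}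
    (hs : 0 ≤ s) :
    HasDerivAt (fun r => flow (h.particleOp hN) r
        (h.deviation N μ r (flow h.killedOp (T - r) φ)
          * h.deviation N μ r (flow h.killedOp (T - r) φ)) η₀)
      (flow (h.particleOp hN) s
        (h.particleOp hN (h.deviation N μ s (flow h.killedOp (T - s) φ)
            * h.deviation N μ s (flow h.killedOp (T - s) φ))
          + (2 : ℝ) • (h.deviation N μ s (flow h.killedOp (T - s) φ)
            * (-empiricalOp F N (h.killedOp (flow h.killedOp (T - s) φ))
              - (h.condLaw μ s (flow h.killedOp (T - s) φ) * h.condLaw μ s h.death) • 1))) η₀)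
      s := by
  have h1 : HasDerivAt (fun r => flow h.killedOp (T - r) φ)
      (-h.killedOp (flow h.killedOp (T - s) φ)) s := by
    have e1 := ((hasDerivAt_flow h.killedOp (T - s)).scomp s
      ((hasDerivAt_id s).const_sub T)).clm_apply (hasDerivAt_const s φ)
    refine e1.congr_deriv ?_
    rw [map_zero, add_zero, neg_one_smul, flow_comm, neg_apply]
    rfl
  have h2 : HasDerivAt (fun r => h.deviation N μ r (flow h.killedOp (T - r) φ))
      (-empiricalOp F N (h.killedOp (flow h.killedOp (T - s) φ))
        - (h.condLaw μ s (flow h.killedOp (T - s) φ) * h.condLaw μ s h.death) • 1) s := by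
    have e1 := (empiricalOp F N).hasFDerivAt.comp_hasDerivAt s h1
    rw [map_neg] at e1
    exact e1.sub ((h.hasDerivAt_condLaw_backward μ T φ hs).smul_const (1 : Bdd (Config F N)))
  have h3 := (Bdd.eval η₀).hasFDerivAt.comp_hasDerivAt s
    ((hasDerivAt_flow (h.particleOp hN) s).clm_apply (h2.mul h2))
  refine h3.congr_deriv ?_
  have h4 : ∀ f g : Bdd (Config F N), f * g + g * f = (2 : ℝ) • (g * f) := fun f g => by
    rw [two_smul, mul_comm f g]
  rw [mul_apply_eq_comp, ← map_add, Bdd.eval_apply, h4]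
  rfl

/-- Bound on the mean square deviation, by Picard iteration: each bound which is uniform over test
functions of norm at most one and over time yields a better one, as the error of the a priori bound
`4` is multiplied by `a s` and integrated. -/
theorem meanSquare_le_add (hN : 2 ≤ N) (η₀ : Config F N)
    (hpos : ∀ s : ℝ, 0 ≤ s → ∀ f : Bdd (Config F N), (∀ η, 0 ≤ f η) →
      0 ≤ flow (h.particleOp hN) s f η₀)
    (hone : ∀ s : ℝ, 0 ≤ s → flow (h.particleOp hN) s 1 η₀ = 1)
    {y₀ : ℝ} (hinit : ∀ f : Bdd F, ‖f‖ ≤ 1 →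
      (empiricalOp F N f η₀ - integralCLM μ f) ^ 2 ≤ y₀) (n : ℕ) :
    ∀ T : ℝ, 0 ≤ T → ∀ φ : Bdd F, ‖φ‖ ≤ 1 →
      flow (h.particleOp hN) T (h.deviation N μ T φ * h.deviation N μ T φ) η₀
        ≤ Real.exp (3 * p * T) * (y₀ + (4 * q + 24 * p) / N * T)
          + 4 * ((3 * p * T) ^ n / n.factorial) := by
  have hp := h.killing_nonneg
  have hq := h.jump_nonneg
  have hy₀ : 0 ≤ y₀ := (sq_nonneg _).trans (hinit 0 (by simp))
  have hmono : ∀ s : ℝ, 0 ≤ s → ∀ f g : Bdd (Config F N), (∀ η, f η ≤ g η) →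
      flow (h.particleOp hN) s f η₀ ≤ flow (h.particleOp hN) s g η₀ := by
    intro s hs f g hfg
    have := hpos s hs (g - f) fun η => by simpa using hfg η
    rw [map_sub, Bdd.sub_apply] at this
    linarith
  set β := (4 * q + 24 * p) / N with hβ
  have hβ0 : 0 ≤ β := by positivity
  induction n with
  | zero =>
    intro T hT φ hφ
    have h1 := hmono T hT (h.deviation N μ T φ * h.deviation N μ T φ) ((4 : ℝ) • 1) fun η => by
      have := h.abs_deviation_le μ hT hφ η
      simp only [Bdd.mul_apply, Bdd.smul_apply, Bdd.one_apply]
      rw [abs_le] at this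
      nlinarith
    rw [map_smul, Bdd.smul_apply, hone T hT] at h1
    have h2 : 0 ≤ Real.exp (3 * p * T) * (y₀ + β * T) := by positivity
    simp only [pow_zero, Nat.factorial_zero, Nat.cast_one, div_one]
    linarith
  | succ n ih =>
    intro T hT φ hφ
    have hd := fun s (hs : 0 ≤ s) => h.hasDerivAt_meanSquare μ hN η₀ T φ hs
    have hB : ∀ s : ℝ, HasDerivAt (fun s => Real.exp (3 * p * s) * (y₀ + β * s)
          + 4 * ((3 * p * s) ^ (n + 1) / (n + 1).factorial))
        (3 * p * (Real.exp (3 * p * s) * (y₀ + β * s) + 4 * ((3 * p * s) ^ n / n.factorial))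
          + Real.exp (3 * p * s) * β) s := by
      intro s
      have e1 : HasDerivAt (fun s => 3 * p * s) (3 * p) s := by
        simpa using (hasDerivAt_id s).const_mul (3 * p)
      have e2 : HasDerivAt (fun s => y₀ + β * s) β s := by
        simpa using ((hasDerivAt_id s).const_mul β).const_add y₀
      have e3 := (e1.exp.mul e2).add
        (((e1.pow (n + 1)).div_const ((n + 1).factorial : ℝ)).const_mul 4)
      refine e3.congr_deriv ?_
      have : (n.factorial : ℝ) ≠ 0 := by positivity
      rw [Nat.factorial_succ, Nat.add_sub_cancel]
      push_cast
      field_simp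
      ring
    have hbound := image_le_of_deriv_right_le_deriv_boundary (a := 0) (b := T)
      (fun s hs => (hd s hs.1).continuousAt.continuousWithinAt)
      (fun s hs => (hd s hs.1).hasDerivWithinAt)
      (B := fun s => Real.exp (3 * p * s) * (y₀ + β * s)
          + 4 * ((3 * p * s) ^ (n + 1) / (n + 1).factorial)) ?_
      (fun s _ => (hB s).continuousAt.continuousWithinAt)
      (fun s _ => (hB s).hasDerivWithinAt) ?_
    · have := hbound ⟨hT, le_rfl⟩
      simpa only [sub_self, flow_zero, one_apply_eq_self] using this
    · have e1 := hinit _ ((h.norm_flow_killedOp_le hT φ).trans hφ)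
      simp only [sub_zero, flow_zero, one_apply_eq_self, Bdd.mul_apply, deviation_apply,
        condLaw_zero, mul_zero, Real.exp_zero, add_zero, one_mul]
      rw [← sq, zero_pow (Nat.succ_ne_zero n), zero_div, mul_zero, add_zero]
      exact e1
    · intro s hs
      have hψ : ‖flow h.killedOp (T - s) φ‖ ≤ 1 :=
        (h.norm_flow_killedOp_le (sub_nonneg.2 hs.2.le) φ).trans hφ
      set ψ := flow h.killedOp (T - s) φ
      have e1 := hmono s hs.1
        (h.particleOp hN (h.deviation N μ s ψ * h.deviation N μ s ψ)
          + (2 : ℝ) • (h.deviation N μ s ψ * (-empiricalOp F N (h.killedOp ψ)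
              - (h.condLaw μ s ψ * h.condLaw μ s h.death) • 1)))
        ((5 * p / 2) • (h.deviation N μ s ψ * h.deviation N μ s ψ)
          + (p / 2) • (h.deviation N μ s h.centredDeath * h.deviation N μ s h.centredDeath)
          + β • 1) fun η => by
            have := h.particleOp_deviation_sq_add_le μ hN hs.1 hψ η
            have hneg : (-empiricalOp F N (h.killedOp ψ)) η
                = -empiricalOp F N (h.killedOp ψ) η := by rw [lp.coeFn_neg]; rfl
            simp only [Bdd.mul_apply, Bdd.smul_apply, Bdd.one_apply, Bdd.add_apply, Bdd.sub_apply,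
              hneg]
            linarith
      simp only [map_add, map_smul, Bdd.add_apply, Bdd.smul_apply, hone s hs.1] at e1
      have e2 := mul_le_mul_of_nonneg_left (ih s hs.1 ψ hψ) (by positivity : 0 ≤ 5 * p / 2)
      have e3 := mul_le_mul_of_nonneg_left (ih s hs.1 _ h.norm_centredDeath_le)
        (by positivity : 0 ≤ p / 2)
      have e4 : β ≤ Real.exp (3 * p * s) * β :=
        le_mul_of_one_le_left hβ0 (Real.one_le_exp (mul_nonneg (by positivity) hs.1))
      simp only [map_add, map_smul, Bdd.add_apply, Bdd.smul_apply]
      linarith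

theorem meanSquare_le (hN : 2 ≤ N) (η₀ : Config F N)
    (hpos : ∀ s : ℝ, 0 ≤ s → ∀ f : Bdd (Config F N), (∀ η, 0 ≤ f η) →
      0 ≤ flow (h.particleOp hN) s f η₀)
    (hone : ∀ s : ℝ, 0 ≤ s → flow (h.particleOp hN) s 1 η₀ = 1)
    {y₀ : ℝ} (hinit : ∀ f : Bdd F, ‖f‖ ≤ 1 →
      (empiricalOp F N f η₀ - integralCLM μ f) ^ 2 ≤ y₀)
    {T : ℝ} (hT : 0 ≤ T) {φ : Bdd F} (hφ : ‖φ‖ ≤ 1) :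
    flow (h.particleOp hN) T (h.deviation N μ T φ * h.deviation N μ T φ) η₀
      ≤ Real.exp (3 * p * T) * (y₀ + (4 * q + 24 * p) / N * T) := by
  have h1 := ((FloorSemiring.tendsto_pow_div_factorial_atTop (3 * p * T)).const_mul 4).const_add
    (Real.exp (3 * p * T) * (y₀ + (4 * q + 24 * p) / N * T))
  rw [mul_zero, add_zero] at h1
  exact ge_of_tendsto' h1 fun n => h.meanSquare_le_add μ hN η₀ hpos hone hinit n T hT φ hφ

end RateBound

end Deviation

/-! ### Removing the diagonal of the rates -/

section OffDiag

variable {F : Type*}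

/-- The rates `Q` with the diagonal set to zero. Neither generator sees the diagonal, on which no
assumption is made. -/
def offDiag (Q : F → F → ℝ) (i : F) : F → ℝ := Set.indicator {j | j ≠ i} (Q i)

theorem offDiag_self (Q : F → F → ℝ) (i : F) : offDiag Q i i = 0 := by simp [offDiag]

theorem offDiag_of_ne (Q : F → F → ℝ) {i j : F} (hij : j ≠ i) : offDiag Q i j = Q i j := by
  simp [offDiag, hij]

theorem killedGenerator_offDiag (Q : F → F → ℝ) (p₀ : F → ℝ) :
    killedGenerator (offDiag Q) p₀ = killedGenerator Q p₀ := by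
  funext f x
  cases x with
  | none => rfl
  | some i =>
    simp only [killedGenerator]
    congr 1
    refine tsum_congr fun j => ?_
    rcases eq_or_ne j i with rfl | hij
    · simp
    · rw [offDiag_of_ne Q hij]

theorem move_self {N : ℕ} (η : Config F N) (i : F) : move η i i = η := by
  by_cases hi : η.1 i ≠ 0
  · have hle : Finsupp.single i 1 ≤ η.1 := by
      rw [Finsupp.single_le_iff]; omega
    exact (dif_pos hi).trans (Subtype.ext (tsub_add_cancel_of_le hle))
  · exact dif_neg hi

theorem particleGenerator_offDiag {N : ℕ} (Q : F → F → ℝ) (p₀ : F → ℝ) :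
    particleGenerator (N := N) (offDiag Q) p₀ = particleGenerator Q p₀ := by
  funext f η
  simp only [particleGenerator]
  refine Finset.sum_congr rfl fun i _ => ?_
  congr 1
  refine tsum_congr fun j => ?_
  rcases eq_or_ne j i with rfl | hij
  · simp [move_self]
  · rw [offDiag_of_ne Q hij]

theorem BoundedRates.rateBound [Nonempty F] {Q : F → F → ℝ} {p₀ : F → ℝ}
    (hQ : ∀ i j, i ≠ j → 0 ≤ Q i j) (hp₀ : ∀ i, 0 ≤ p₀ i) (hA : BoundedRates Q p₀) :
    RateBound (offDiag Q) p₀ (supExitRate Q) (supDeathRate p₀) := by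
  have h0 : ∀ i j, 0 ≤ offDiag Q i j := fun i j => by
    rcases eq_or_ne j i with rfl | hij
    · rw [offDiag_self]
    · rw [offDiag_of_ne Q hij]; exact hQ i j hij.symm
  have h1 : ∀ i, ∑' j, offDiag Q i j ≤ supExitRate Q := fun i => by
    have e1 : exitRate Q i = ∑' j, offDiag Q i j := tsum_subtype {j | j ≠ i} (Q i)
    rw [← e1]
    exact le_ciSup hA.bddAbove_exit i
  have h2 : ∀ i, p₀ i ≤ supDeathRate p₀ := fun i => le_ciSup hA.bddAbove_death i
  obtain ⟨i₀⟩ := ‹Nonempty F›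
  exact
    { nonneg := h0
      summable := fun i => summable_subtype_iff_indicator.1 (hA.summable i)
      tsum_le := h1
      death_nonneg := hp₀
      death_le := h2
      jump_nonneg := (tsum_nonneg (h0 i₀)).trans (h1 i₀)
      killing_nonneg := (hp₀ i₀).trans (h2 i₀) }

end OffDiag

/-! ### One-time marginals, empirical measures and total variation -/

section Marginals

variable {S Ω : Type*} [MeasurableSpace Ω] {P : Measure Ω} [IsProbabilityMeasure P]

theorem IsMarkovProcess.integrable {A : (S → ℝ) → (S → ℝ)} {X : ℝ≥0 → Ω → S}
    (hX : IsMarkovProcess A P X) (t : ℝ≥0) (f : Bdd S) : Integrable (fun ω => f (X t ω)) P := by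
  let _ : MeasurableSpace S := ⊤
  exact Integrable.of_bound
    ((measurable_from_top (f := ⇑f)).comp (hX.measurable t)).aestronglyMeasurable ‖f‖
    (Filter.Eventually.of_forall fun ω => abs_apply_le_norm f (X t ω))

/-- The one-time marginals of a Markov process started from `x₀` are given by its semigroup: this is
the Markov property at time `0`, integrated. -/
theorem IsMarkovProcess.integral_eq {A : (S → ℝ) → (S → ℝ)} {X : ℝ≥0 → Ω → S}
    (hX : IsMarkovProcess A P X) {x₀ : S} (h₀ : ∀ᵐ ω ∂P, X 0 ω = x₀) (t : ℝ≥0) (f : Bdd S) :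
    ∫ ω, f (X t ω) ∂P = semigroup A t f x₀ := by
  have hle : (⨆ r : {r : ℝ≥0 // r ≤ 0}, MeasurableSpace.comap (X r) ⊤) ≤ ‹MeasurableSpace Ω› :=
    iSup_le fun r => (hX.measurable r).comap_le
  have h1 := hX.markov 0 t f ⟨‖f‖, abs_apply_le_norm f⟩
  rw [zero_add] at h1
  rw [← integral_condExp hle, integral_congr_ae h1]
  have h2 : (fun ω => semigroup A t f (X 0 ω)) =ᵐ[P] fun _ => semigroup A t f x₀ := by
    filter_upwards [h₀] with ω hω
    rw [hω]
  rw [integral_congr_ae h2]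
  simp

end Marginals

section Measures

variable {F : Type*} [MeasurableSpace F] [DiscreteMeasurableSpace F]

theorem integral_empirical {N : ℕ} (η : Config F N) (f : Bdd F) :
    ∫ k, f k ∂(empirical η) = empiricalOp F N f η := by
  have hint : ∀ k ∈ η.1.support, Integrable (⇑f) ((η.1 k : ℝ≥0∞) • Measure.dirac k) :=
    fun k _ => (integrable_dirac (by simp)).smul_measure (ENNReal.natCast_ne_top _)
  rw [empirical, integral_smul_measure, integral_finsetSum_measure hint, empiricalOp_apply]
  simp [integral_smul_measure]

theorem two_mul_tvDist_ge [Countable F] {N : ℕ} (η : Config F N) (μ : Measure F)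
    [IsProbabilityMeasure μ] {f : Bdd F} (hf : ‖f‖ ≤ 1) :
    |empiricalOp F N f η - integralCLM μ f| ≤ 2 * tvDist (empirical η) μ := by
  have key : ∀ g : {f : F → ℝ // ∀ x, |f x| ≤ 1},
      ∫ x, g.1 x ∂(empirical η) - ∫ x, g.1 x ∂μ
        = empiricalOp F N (toBdd g.1 ⟨1, g.2⟩) η - integralCLM μ (toBdd g.1 ⟨1, g.2⟩) := fun g => by
    rw [← integral_empirical, integralCLM_apply]; rfl
  have hbdd : BddAbove (Set.range fun g : {f : F → ℝ // ∀ x, |f x| ≤ 1} =>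
      ∫ x, g.1 x ∂(empirical η) - ∫ x, g.1 x ∂μ) := by
    refine ⟨2, ?_⟩
    rintro _ ⟨g, rfl⟩
    have hg : ‖toBdd g.1 ⟨1, g.2⟩‖ ≤ 1 := Bdd.norm_le zero_le_one g.2
    have h1 := (abs_le.1 ((abs_empiricalOp_le (toBdd g.1 ⟨1, g.2⟩) η).trans hg)).2
    have h2 := integralCLM_mono μ (f := (-1 : ℝ) • 1) (g := toBdd g.1 ⟨1, g.2⟩) fun x => by
      rw [Bdd.smul_apply, Bdd.one_apply, mul_one]
      exact (abs_le.1 (g.2 x)).1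
    rw [map_smul, integralCLM_one, smul_eq_mul] at h2
    simp only [key]
    linarith
  have hle : ∀ g : Bdd F, ‖g‖ ≤ 1 →
      empiricalOp F N g η - integralCLM μ g ≤ 2 * tvDist (empirical η) μ := by
    intro g hg
    have h1 := le_ciSup hbdd ⟨g, fun x => (abs_apply_le_norm g x).trans hg⟩
    simp only [integral_empirical] at h1
    rw [tvDist, ← mul_assoc]
    simpa [integralCLM_apply] using h1
  have h1 := hle f hf
  have h2 := hle (-f) (by rwa [norm_neg])
  rw [map_neg, map_neg, lp.coeFn_neg, Pi.neg_apply] at h2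
  rw [abs_le]
  constructor <;> linarith

end Measures

end FlemingViot

end

theorem mainTheorem4 {F : Type*} [Countable F] [MeasurableSpace F] [DiscreteMeasurableSpace F]
    (Q : F → F → ℝ) (p₀ : F → ℝ)
    (hQ : ∀ i j, i ≠ j → 0 ≤ Q i j) (hp₀ : ∀ i, 0 ≤ p₀ i)
    (hA : FlemingViot.BoundedRates Q p₀)
    (N : ℕ) (hN : 2 ≤ N) (η₀ : FlemingViot.Config F N)
    (μ : Measure F) [IsProbabilityMeasure μ]
    {Ω : Type*} [MeasurableSpace Ω] (P : Measure Ω) [IsProbabilityMeasure P]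
    (η : ℝ≥0 → Ω → FlemingViot.Config F N)
    (hη : FlemingViot.IsMarkovProcess (FlemingViot.particleGenerator Q p₀) P η)
    (hη₀ : ∀ᵐ ω ∂P, η 0 ω = η₀)
    (t : ℝ≥0) (φ : F → ℝ) (hφ : ∀ k, |φ k| ≤ 1) :
    ∫ ω, |∫ k, φ k ∂(FlemingViot.empirical (η t ω))
        - FlemingViot.conditionedLaw Q p₀ μ t φ| ∂P
      ≤ 10 * Real.exp ((FlemingViot.supExitRate Q + 2 * FlemingViot.supDeathRate p₀) * t)
          * (1 / Real.sqrt N + FlemingViot.tvDist (FlemingViot.empirical η₀) μ) := by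
  -- There are at least two particles, so there is a site; hence the suprema of the rates are
  -- genuine non-negative bounds.
  open FlemingViot in
  have : Nonempty F := by
    by_contra hF
    rw [not_nonempty_iff] at hF
    have := η₀.2
    rw [Finset.sum_of_isEmpty] at this
    omega
  have h := BoundedRates.rateBound hQ hp₀ hA
  rw [← particleGenerator_offDiag] at hη
  set q := supExitRate Q
  set p := supDeathRate p₀
  set d := tvDist (empirical η₀) μ
  have hq := h.jump_nonneg
  have hp := h.killing_nonneg
  set f : Bdd F := toBdd φ ⟨1, hφ⟩
  have hf : ‖f‖ ≤ 1 := Bdd.norm_le zero_le_one hφ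
  have hE : ∀ (s : ℝ≥0) (g : Bdd (Config F N)),
      ∫ ω, g (η s ω) ∂P = flow (h.particleOp hN) s g η₀ := fun s g => by
    rw [hη.integral_eq hη₀, semigroup_eq_flow (A := h.particleOp hN) fun g => rfl]
  have hd : 0 ≤ d := by
    have := two_mul_tvDist_ge η₀ μ hf
    linarith [abs_nonneg (empiricalOp F N f η₀ - integralCLM μ f)]
  have hsq := h.meanSquare_le μ hN η₀ (y₀ := (2 * d) ^ 2)
    (fun s hs g hg => (integral_nonneg fun ω => hg _).trans_eq (hE ⟨s, hs⟩ g))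
    (fun s hs => (hE ⟨s, hs⟩ 1).symm.trans (by simp))
    (fun g hg => by
      rw [← sq_abs]
      exact pow_le_pow_left₀ (abs_nonneg _) (two_mul_tvDist_ge η₀ μ hg) 2)
    t.coe_nonneg hf
  set D := h.deviation N μ t f
  rw [← hE t] at hsq
  have hD : ∀ ω, |∫ k, φ k ∂(empirical (η t ω)) - conditionedLaw Q p₀ μ t φ| = |D (η t ω)| := by
    intro ω
    have e1 := h.conditionedLaw_eq μ t f
    have e2 := integral_empirical (η t ω) f
    have e3 : conditionedLaw (offDiag Q) p₀ μ t f = conditionedLaw Q p₀ μ t φ := by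
      simp only [conditionedLaw, killedLaw, killedGenerator_offDiag]
      rfl
    rw [h.deviation_apply, ← e1, ← e2, e3]
    rfl
  simp only [hD]
  have hN0 : (0 : ℝ) < N := by positivity
  set R := 10 * Real.exp ((q + 2 * p) * t) * (1 / Real.sqrt N + d)
  have hR : 0 < R := by positivity
  -- It suffices to bound the second moment, since `2 R |x| ≤ x² + R²`.
  have hsqR : ∫ ω, (D * D) (η t ω) ∂P ≤ R ^ 2 := by
    have ht : 0 ≤ (t : ℝ) := t.coe_nonneg
    -- With `x = B t / 2`, the square of the exponential factor is `exp (3 x) exp x`; the first factor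
    -- dominates `exp (3 p t)` and the second one, being at least `1 + x`, the linear growth in `t`.
    set x := (q + 2 * p) * t / 2 with hx
    have hx0 : 0 ≤ x := by positivity
    have e1 : Real.exp (3 * p * t) ≤ Real.exp (3 * x) := by
      refine Real.exp_le_exp.2 ?_
      have := mul_nonneg hq ht
      rw [hx]
      linarith
    have e2 : (4 * q + 24 * p) / N * t ≤ 24 * x / N := by
      rw [div_mul_eq_mul_div]
      refine div_le_div_of_nonneg_right ?_ hN0.le
      have := mul_nonneg hq ht
      rw [hx]
      linarith
    have e3 : 1 / (N : ℝ) + d ^ 2 ≤ (1 / Real.sqrt N + d) ^ 2 := by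
      have : (1 / Real.sqrt N) ^ 2 = 1 / (N : ℝ) := by
        rw [div_pow, Real.sq_sqrt hN0.le, one_pow]
      have h2 : 0 ≤ 1 / Real.sqrt N * d := by positivity
      rw [add_sq, this]
      linarith
    have e4 : R ^ 2 = Real.exp (3 * x) * (Real.exp x * (100 * (1 / Real.sqrt N + d) ^ 2)) := by
      have : Real.exp ((q + 2 * p) * t) ^ 2 = Real.exp (3 * x) * Real.exp x := by
        rw [← Real.exp_add, ← Real.exp_nat_mul]
        congr 1
        rw [hx]
        push_cast
        ring
      rw [← mul_assoc (Real.exp (3 * x)), ← this]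
      ring
    have e5 : (1 + x) * (100 * (1 / (N : ℝ) + d ^ 2))
        ≤ Real.exp x * (100 * (1 / Real.sqrt N + d) ^ 2) := by
      have := Real.add_one_le_exp x
      exact mul_le_mul (by linarith) (by linarith) (by positivity) (Real.exp_pos _).le
    have e6 : (2 * d) ^ 2 + 24 * x / N ≤ (1 + x) * (100 * (1 / (N : ℝ) + d ^ 2)) := by
      have a1 : 0 ≤ x / N := by positivity
      have a2 : 0 ≤ 1 / (N : ℝ) := by positivity
      have a3 : 0 ≤ x * d ^ 2 := by positivity
      have a4 : (1 + x) * (100 * (1 / (N : ℝ) + d ^ 2))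
          = 100 * (1 / (N : ℝ)) + 100 * d ^ 2 + 100 * (x / N) + 100 * (x * d ^ 2) := by ring
      have a5 : 24 * x / N = 24 * (x / N) := by ring
      rw [a4, a5]
      nlinarith [sq_nonneg d]
    rw [e4]
    refine hsq.trans (mul_le_mul e1 ?_ (by positivity) (Real.exp_pos _).le)
    exact (add_le_add le_rfl e2).trans (e6.trans e5)
  have habs : ∫ ω, 2 * R * |D (η t ω)| ∂P ≤ ∫ ω, ((D * D) (η t ω) + R ^ 2) ∂P := by
    refine integral_mono ((hη.integrable t D).abs.const_mul _)
      ((hη.integrable t (D * D)).add (integrable_const _)) fun ω => ?_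
    simp only [Bdd.mul_apply]
    rw [← abs_mul_abs_self]
    nlinarith [sq_nonneg (|D (η t ω)| - R)]
  rw [integral_const_mul, integral_add (hη.integrable t (D * D)) (integrable_const _)] at habs
  simp only [integral_const, probReal_univ, one_smul] at habs
  nlinarith
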